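/- Let $k$ be a field and let $\Lambda$ be a cyclic Nakayama algebra over $k$, that is, $\Lambda\cong kQ/\langle R\rangle$, where $Q$ is the cyclic quiver with vertices $i\in\mathbb{Z}/N$ and arrows $\alpha_i\colon i\to i+1$ ($N\ge 1$), $kQ$ is its path algebra, and $R$ is a nonempty finite set of paths of length at least $2$. Modules are finitely generated left $\Lambda$-modules (paths are composed from right to left). Let $$\operatorname{findim}\Lambda=\sup\{\operatorname{pd}M : \operatorname{pd}M<\infty\}.$$ Let $K_0$ be the abelian group generated by the symbols $[M]$ of the modules $M$, subject to $[M]=[X]+[Y]$ whenever $M\cong X\oplus Y$, and $[P]=0$ whenever $P$ is projective. Let $L\colon K_0\to K_0$ be the homomorphism with $L[M]=[\Omega M]$, where $\Omega M$ is the first syzygy of $M$. For a module $M$ let $\langle\operatorname{add}M\rangle\subseteq K_0$ be the subgroup generated by the classes of the indecomposable direct summands of $M$, and put $$\varphi(M)=\min\{t\ge 0 : \operatorname{rank}L^t\langle\operatorname{add}M\rangle=\operatorname{rank}L^{t+j}\langle\operatorname{add}M\rangle\ \text{for all } j\ge 1\},\qquad \varphi\dim\Lambda=\sup_M\varphi(M).$$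 Then $\varphi\dim\Lambda$ and $\operatorname{findim}\Lambda$ are finite, and $$\varphi\dim\Lambda-\operatorname{findim}\Lambda\le 1.$$ -/

import Mathlib

open CategoryTheory

universe u v

noncomputable section

/-! ## Finitistic dimension and the Igusa-Todorov dimension -/

namespace Homological

variable (A : Type v) [Ring A]

/-- The (little) finitistic dimension of `A`: the supremum of the projective dimensions of the
finitely generated left `A`-modules of finite projective dimension. -/
def finDim : ℕ∞ :=
  ⨆ (n : ℕ) (_ : ∃ M : FGModuleCat.{v} A, projectiveDimension M.obj = n), (n : ℕ∞)

/-- The free abelian group on the symbols `[M]`, `M` a finitely generated left `A`-module. -/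
abbrev FreeFG : Type (v + 1) := FGModuleCat.{v} A →₀ ℤ

/-- The symbol `[M]` in the free abelian group. -/
abbrev FreeFG.symbol {A : Type v} [Ring A] (M : FGModuleCat.{v} A) : FreeFG A :=
  Finsupp.single M 1

/-- The relations `[M] = [X] + [Y]` if `M ≅ X ⊕ Y`, and `[P] = 0` if `P` is projective. -/
inductive KRel : FreeFG A → Prop
  | sum (M X Y : FGModuleCat.{v} A) (e : M ≃ₗ[A] (X × Y)) :
      KRel (FreeFG.symbol M - (FreeFG.symbol X + FreeFG.symbol Y))
  | proj (P : FGModuleCat.{v} A) (h : Module.Projective A P) : KRel (FreeFG.symbol P)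

/-- The group `K₀` of the Igusa-Todorov construction. -/
abbrev K : Type (v + 1) := FreeFG A ⧸ Submodule.span ℤ {x | KRel A x}

variable {A}

/-- The class `[M]` in `K₀`. -/
def cls (M : FGModuleCat.{v} A) : K A := Submodule.Quotient.mk (FreeFG.symbol M)

lemma cls_sum {M X Y : FGModuleCat.{v} A} (e : M ≃ₗ[A] (X × Y)) : cls M = cls X + cls Y :=
  (Submodule.Quotient.eq _).2 (Submodule.subset_span (KRel.sum M X Y e))

lemma cls_proj (P : FGModuleCat.{v} A) (h : Module.Projective A P) : cls P = 0 :=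
  (Submodule.Quotient.mk_eq_zero _).2 (Submodule.subset_span (KRel.proj P h))

lemma cls_prod (X Y : FGModuleCat.{v} A) : cls (FGModuleCat.of A (X × Y)) = cls X + cls Y :=
  cls_sum (LinearEquiv.refl A (X × Y))

/-- Schanuel's lemma, with an explicit isomorphism. -/
def schanuel {M P Q : Type v} [AddCommGroup M] [Module A M] [AddCommGroup P] [Module A P]
    [AddCommGroup Q] [Module A Q] (f : P →ₗ[A] M) (g : Q →ₗ[A] M) (h : P →ₗ[A] Q)
    (h' : Q →ₗ[A] P) (hh : g ∘ₗ h = f) (hh' : f ∘ₗ h' = g) :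
    (LinearMap.ker f × Q) ≃ₗ[A] (LinearMap.ker g × P) where
  toFun x := (⟨x.2 + h (x.1 - h' x.2), by
    have h1 : ∀ p, g (h p) = f p := fun p => LinearMap.congr_fun hh p
    have h2 : ∀ q, f (h' q) = g q := fun q => LinearMap.congr_fun hh' q
    have h3 : f x.1 = 0 := x.1.2
    rw [LinearMap.mem_ker, map_add, h1, map_sub, h2, h3]; abel⟩, x.1 - h' x.2)
  invFun y := (⟨y.2 + h' (y.1 - h y.2), by
    have h1 : ∀ p, g (h p) = f p := fun p => LinearMap.congr_fun hh p
    have h2 : ∀ q, f (h' q) = g q := fun q => LinearMap.congr_fun hh' q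
    have h3 : g y.1 = 0 := y.1.2
    rw [LinearMap.mem_ker, map_add, h2, map_sub, h1, h3]; abel⟩, y.1 - h y.2)
  map_add' x y := by
    ext <;> simp <;> abel
  map_smul' c x := by
    ext <;> simp [smul_add, smul_sub]
  left_inv x := by
    ext <;> simp
  right_inv x := by
    ext <;> simp

/-- The kernel of `f ⊕ g`, followed by an isomorphism, is `ker f ⊕ ker g`. -/
def kerProd {M X Y P Q : Type v} [AddCommGroup M] [Module A M] [AddCommGroup X] [Module A X]
    [AddCommGroup Y] [Module A Y] [AddCommGroup P] [Module A P] [AddCommGroup Q] [Module A Q]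
    (f : P →ₗ[A] X) (g : Q →ₗ[A] Y) (e : (X × Y) ≃ₗ[A] M) :
    LinearMap.ker (e.toLinearMap ∘ₗ f.prodMap g) ≃ₗ[A] (LinearMap.ker f × LinearMap.ker g) where
  toFun x := (⟨x.1.1, by have h := x.2; simp at h; exact h.1⟩,
    ⟨x.1.2, by have h := x.2; simp at h; exact h.2⟩)
  invFun y := ⟨(y.1.1, y.2.1), by simp⟩
  map_add' x y := rfl
  map_smul' c x := rfl
  left_inv x := rfl
  right_inv y := rfl

/-- A chosen presentation: the rank of a finitely generated free module that maps onto `M`. -/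
def coverRank (M : FGModuleCat.{v} A) : ℕ := (Module.Finite.exists_fin' A M).choose

/-- A chosen surjection from a finitely generated free module onto `M`. -/
def coverMap (M : FGModuleCat.{v} A) : (Fin (coverRank M) → A) →ₗ[A] M :=
  (Module.Finite.exists_fin' A M).choose_spec.choose

lemma coverMap_surjective (M : FGModuleCat.{v} A) : Function.Surjective (coverMap M) :=
  (Module.Finite.exists_fin' A M).choose_spec.choose_spec

section Noetherian

variable [IsNoetherianRing A]

/-- The kernel of a map between finitely generated modules, as a finitely generated module. -/
abbrev kerFG {P M : Type v} [AddCommGroup P] [Module A P] [Module.Finite A P] [AddCommGroup M]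
    [Module A M] (f : P →ₗ[A] M) : FGModuleCat.{v} A :=
  FGModuleCat.of A (LinearMap.ker f)

/-- The class of the kernel of a projective presentation does not depend on the presentation. -/
lemma cls_ker_eq {M P Q : Type v} [AddCommGroup M] [Module A M] [AddCommGroup P] [Module A P]
    [AddCommGroup Q] [Module A Q] [Module.Finite A P] [Module.Finite A Q]
    [Module.Projective A P] [Module.Projective A Q] (f : P →ₗ[A] M) (g : Q →ₗ[A] M)
    (hf : Function.Surjective f) (hg : Function.Surjective g) :
    cls (kerFG f) = cls (kerFG g) := by
  obtain ⟨h, hh⟩ := Module.projective_lifting_property g f hg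
  obtain ⟨h', hh'⟩ := Module.projective_lifting_property f g hf
  have key : cls (FGModuleCat.of A (LinearMap.ker f × Q)) = cls (kerFG g) + cls (.of A P) :=
    cls_sum (X := kerFG g) (Y := .of A P) (schanuel f g h h' hh hh')
  have key' : cls (FGModuleCat.of A (LinearMap.ker f × Q)) = cls (kerFG f) + cls (.of A Q) :=
    cls_prod (kerFG f) (.of A Q)
  rw [key', cls_proj (.of A P) ‹_›, cls_proj (.of A Q) ‹_›, add_zero, add_zero] at key
  exact key

/-- A first syzygy of `M`. Its class in `K₀` is that of the kernel of any surjection from a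
finitely generated projective module (in particular of the projective cover, if there is one)
onto `M`: see `L_cls`. -/
def Omega (M : FGModuleCat.{v} A) : FGModuleCat.{v} A := kerFG (coverMap M)

lemma cls_Omega (M : FGModuleCat.{v} A) {P : Type v} [AddCommGroup P] [Module A P]
    [Module.Finite A P] [Module.Projective A P] (f : P →ₗ[A] M) (hf : Function.Surjective f) :
    cls (Omega M) = cls (kerFG f) :=
  cls_ker_eq _ _ (coverMap_surjective M) hf

variable (A) in
/-- The homomorphism `L : K₀ → K₀`, `L [M] = [Ω M]`. -/
def L : Module.End ℤ (K A) :=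
  Submodule.liftQ _ (Finsupp.linearCombination ℤ fun M : FGModuleCat.{v} A => cls (Omega M)) <| by
    rw [Submodule.span_le]
    rintro _ (⟨M, X, Y, e⟩ | ⟨P, hP⟩)
    · have h1 : cls (Omega M) = cls (Omega X) + cls (Omega Y) := by
        have hs : Function.Surjective
            (e.symm.toLinearMap ∘ₗ (coverMap X).prodMap (coverMap Y)) :=
          e.symm.surjective.comp
            (Prod.map_surjective.2 ⟨coverMap_surjective X, coverMap_surjective Y⟩)
        rw [cls_Omega M _ hs]
        refine cls_sum (X := Omega X) (Y := Omega Y) ?_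
        exact kerProd (coverMap X) (coverMap Y) e.symm
      simp [h1]
    · have h1 : cls (Omega P) = 0 := by
        rw [cls_Omega P LinearMap.id Function.surjective_id]
        refine cls_proj _ ?_
        have : Subsingleton (LinearMap.ker (LinearMap.id : P →ₗ[A] P)) := by
          rw [LinearMap.ker_id]; infer_instance
        exact Module.Projective.of_free
      simp [h1]

lemma L_cls (M : FGModuleCat.{v} A) {P : Type v} [AddCommGroup P] [Module A P]
    [Module.Finite A P] [Module.Projective A P] (f : P →ₗ[A] M) (hf : Function.Surjective f) :
    L A (cls M) = cls (kerFG f) := by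
  rw [← cls_Omega M f hf]
  simp [L, cls]

/-- The subgroup `⟨add M⟩` of `K₀` generated by the indecomposable direct summands of `M`. -/
def addSpan (M : FGModuleCat.{v} A) : Submodule ℤ (K A) :=
  Submodule.span ℤ {x | ∃ X Y : FGModuleCat.{v} A,
    Indecomposable X.obj ∧ Nonempty (M ≃ₗ[A] (X × Y)) ∧ x = cls X}

/-- The rank of the free abelian group `L ^ t ⟨add M⟩`. -/
def rankL (M : FGModuleCat.{v} A) (t : ℕ) : ℕ :=
  Module.finrank ℤ ((addSpan M).map (L A ^ t))

/-- The Igusa-Todorov function `φ`. -/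
def phi (M : FGModuleCat.{v} A) : ℕ :=
  sInf {t | ∀ j, 1 ≤ j → rankL M t = rankL M (t + j)}

variable (A) in
/-- The `φ`-dimension of `A`. -/
def phiDim : ℕ∞ := ⨆ M : FGModuleCat.{v} A, (phi M : ℕ∞)

end Noetherian

end Homological

/-! ## Cyclic Nakayama algebras -/

namespace CyclicQuiver

/-- A path of the cyclic quiver with vertex set `ZMod N` and one arrow `α i : i ⟶ i + 1` for every
vertex `i`. A path is determined by its starting vertex and its length: the path `⟨i, l⟩` is
`α (i + l - 1) ⋯ α (i + 1) α i`, and it ends at the vertex `i + l`. -/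
@[ext]
structure CPath (N : ℕ) where
  start : ZMod N
  length : ℕ

variable (k : Type u) [Field k] (N : ℕ)

/-- The path algebra of the cyclic quiver: the vector space on the set of all paths. -/
def PathAlgebra : Type u := CPath N →₀ k

namespace PathAlgebra

instance : AddCommGroup (PathAlgebra k N) := inferInstanceAs (AddCommGroup (CPath N →₀ k))
instance : Module k (PathAlgebra k N) := inferInstanceAs (Module k (CPath N →₀ k))

variable {N} in
/-- The basis vector of the path algebra that belongs to a path. -/
def of (p : CPath N) : PathAlgebra k N := Finsupp.single p (1 : k)

/-- The paths form a basis. -/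
def basis : Module.Basis (CPath N) k (PathAlgebra k N) :=
  ⟨LinearEquiv.refl k (CPath N →₀ k)⟩

lemma basis_apply (p : CPath N) : basis k N p = of k p := rfl

variable {N} in
/-- The product of paths (composed from right to left): `p q` is "first `q`, then `p`" if `q` ends
where `p` starts, and zero otherwise. -/
def pathMul (p q : CPath N) : PathAlgebra k N :=
  if q.start + q.length = p.start then of k ⟨q.start, q.length + p.length⟩ else 0

/-- The bilinear extension of the product of paths. -/
def mulLin : PathAlgebra k N →ₗ[k] PathAlgebra k N →ₗ[k] PathAlgebra k N :=
  (basis k N).constr k fun p => (basis k N).constr k fun q => pathMul k p q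

instance : Mul (PathAlgebra k N) := ⟨fun x y => mulLin k N x y⟩

lemma mul_def (x y : PathAlgebra k N) : x * y = mulLin k N x y := rfl

lemma of_mul_of (p q : CPath N) : of k p * of k q = pathMul k p q := by
  rw [mul_def, ← basis_apply, ← basis_apply, mulLin, Module.Basis.constr_basis,
    Module.Basis.constr_basis]

/-- The unit is the sum of the trivial paths. -/
instance [NeZero N] : One (PathAlgebra k N) := ⟨∑ i : ZMod N, of k ⟨i, 0⟩⟩

lemma one_def [NeZero N] : (1 : PathAlgebra k N) = ∑ i : ZMod N, of k ⟨i, 0⟩ := rfl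

variable {k N} in
lemma induction {motive : PathAlgebra k N → Prop} (h0 : motive 0)
    (hadd : ∀ x y, motive x → motive y → motive (x + y))
    (hof : ∀ (c : k) (p : CPath N), motive (c • of k p)) (x : PathAlgebra k N) : motive x := by
  refine Finsupp.induction_linear x h0 hadd fun p c => ?_
  have h := hof c p
  have e : c • of k p = (Finsupp.single p c : CPath N →₀ k) :=
    (Finsupp.smul_single c p (1 : k)).trans (by rw [smul_eq_mul, mul_one])
  rwa [e] at h

lemma pathMul_assoc (p q r : CPath N) :
    mulLin k N (pathMul k p q) (of k r) = mulLin k N (of k p) (pathMul k q r) := by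
  have h (p q : CPath N) : mulLin k N (of k p) (of k q) = pathMul k p q := of_mul_of k N p q
  by_cases h1 : q.start + q.length = p.start <;> by_cases h2 : r.start + r.length = q.start
  · have h3 : r.start + ((r.length + q.length : ℕ) : ZMod N) = p.start := by
      rw [Nat.cast_add, ← add_assoc, h2, h1]
    rw [pathMul, if_pos h1, pathMul, if_pos h2, h, h, pathMul, if_pos (by rw [h2]), pathMul,
      if_pos h3, add_assoc]
  · simp [pathMul, h, h1, h2]
  · have h3 : ¬ r.start + ((r.length + q.length : ℕ) : ZMod N) = p.start := by
      rw [Nat.cast_add, ← add_assoc, h2]; exact h1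
    rw [pathMul, if_neg h1, pathMul, if_pos h2, h, pathMul, if_neg h3]; simp
  · simp [pathMul, h1, h2]

lemma mulLin_assoc (x y z : PathAlgebra k N) :
    mulLin k N (mulLin k N x y) z = mulLin k N x (mulLin k N y z) := by
  have h (p q : CPath N) : mulLin k N (of k p) (of k q) = pathMul k p q := of_mul_of k N p q
  induction x using PathAlgebra.induction with
  | h0 => simp
  | hadd x x' hx hx' => simp [hx, hx']
  | hof a p =>
    induction y using PathAlgebra.induction with
    | h0 => simp
    | hadd y y' hy hy' => simp only [map_add, LinearMap.add_apply, hy, hy']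
    | hof b q =>
      induction z using PathAlgebra.induction with
      | h0 => simp
      | hadd z z' hz hz' => simp only [map_add, hz, hz']
      | hof c r =>
        simp only [map_smul, LinearMap.smul_apply, h, pathMul_assoc]

instance [NeZero N] : Ring (PathAlgebra k N) where
  __ := (inferInstance : AddCommGroup (PathAlgebra k N))
  __ := (inferInstance : Mul (PathAlgebra k N))
  __ := (inferInstance : One (PathAlgebra k N))
  left_distrib x y z := map_add (mulLin k N x) y z
  right_distrib x y z := LinearMap.map_add₂ (mulLin k N) x y z
  zero_mul x := LinearMap.map_zero₂ (mulLin k N) x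
  mul_zero x := map_zero (mulLin k N x)
  mul_assoc x y z := mulLin_assoc k N x y z
  one_mul x := by
    change mulLin k N (∑ i : ZMod N, of k ⟨i, 0⟩) x = x
    have h (p q : CPath N) : mulLin k N (of k p) (of k q) = pathMul k p q := of_mul_of k N p q
    induction x using PathAlgebra.induction with
    | h0 => simp
    | hadd x y hx hy => rw [map_add, hx, hy]
    | hof c p => simp [h, pathMul]
  mul_one x := by
    change mulLin k N x (∑ i : ZMod N, of k ⟨i, 0⟩) = x
    have h (p q : CPath N) : mulLin k N (of k p) (of k q) = pathMul k p q := of_mul_of k N p q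
    induction x using PathAlgebra.induction with
    | h0 => simp
    | hadd x y hx hy => rw [map_add, LinearMap.add_apply, hx, hy]
    | hof c p => simp [h, pathMul]

instance [NeZero N] : Algebra k (PathAlgebra k N) :=
  Algebra.ofModule (fun c x y => LinearMap.map_smul₂ (mulLin k N) c x y)
    (fun c x y => map_smul (mulLin k N x) c y)

end PathAlgebra

variable {N} in
/-- The two-sided ideal of the path algebra generated by a set of paths. -/
def relIdeal [NeZero N] (R : Finset (CPath N)) : TwoSidedIdeal (PathAlgebra k N) :=
  TwoSidedIdeal.span {x | ∃ p ∈ R, x = PathAlgebra.of k p}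

variable {N} in
/-- The bound quiver algebra `kQ / ⟨R⟩` of the cyclic quiver, with the zero relations `R`. -/
abbrev BoundQuiverAlgebra [NeZero N] (R : Finset (CPath N)) : Type u :=
  (relIdeal k R).ringCon.Quotient

variable {N} in
lemma BoundQuiverAlgebra.finite [NeZero N] (R : Finset (CPath N)) (hR : R.Nonempty) :
    Module.Finite k (BoundQuiverAlgebra k R) := by
  obtain ⟨r, hr⟩ := hR
  let π : PathAlgebra k N →ₐ[k] BoundQuiverAlgebra k R := (relIdeal k R).ringCon.mkₐ k
  have hπ : Function.Surjective π := RingCon.mkₐ_surjective _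
  have hrel : π (PathAlgebra.of k r) = 0 :=
    ((relIdeal k R).ringCon.eq).2 (TwoSidedIdeal.subset_span ⟨r, hr, rfl⟩)
  -- a path of length at least `N + r.length` passes through the relation `r`
  have hlong (p : CPath N) (hp : N + r.length ≤ p.length) : π (PathAlgebra.of k p) = 0 := by
    obtain ⟨i, m⟩ := p
    simp only at hp
    let t := (r.start - i).val
    have ht : t < N := ZMod.val_lt _
    have hti : (t : ZMod N) = r.start - i := ZMod.natCast_zmod_val _
    have h1 : PathAlgebra.of k r * PathAlgebra.of k ⟨i, t⟩ =
        PathAlgebra.of k ⟨i, t + r.length⟩ := by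
      rw [PathAlgebra.of_mul_of, PathAlgebra.pathMul, if_pos]
      simp [hti]
    have h2 : PathAlgebra.of k ⟨r.start + (r.length : ZMod N), m - t - r.length⟩ *
        PathAlgebra.of k ⟨i, t + r.length⟩ = PathAlgebra.of k ⟨i, m⟩ := by
      rw [PathAlgebra.of_mul_of, PathAlgebra.pathMul, if_pos (by push_cast; rw [hti]; abel)]
      have : t + r.length + (m - t - r.length) = m := by omega
      simp [this]
    rw [← h2, ← h1, map_mul, map_mul, hrel, zero_mul, mul_zero]
  let S : Set (BoundQuiverAlgebra k R) :=
    Set.range fun x : ZMod N × Fin (N + r.length) => π (PathAlgebra.of k ⟨x.1, x.2⟩)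
  have hS : S.Finite := Set.finite_range _
  refine ⟨⟨hS.toFinset, ?_⟩⟩
  rw [Set.Finite.coe_toFinset, eq_top_iff]
  rintro y -
  obtain ⟨x, rfl⟩ := hπ y
  induction x using PathAlgebra.induction with
  | h0 => simp
  | hadd x y hx hy => rw [map_add]; exact add_mem hx hy
  | hof c p =>
    rw [map_smul]
    refine Submodule.smul_mem _ _ ?_
    by_cases hp : p.length < N + r.length
    · exact Submodule.subset_span ⟨(p.start, ⟨p.length, hp⟩), rfl⟩
    · rw [hlong p (not_lt.1 hp)]
      exact zero_mem _

end CyclicQuiver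

open CyclicQuiver in
/-- A `k`-algebra is a cyclic Nakayama algebra if it is isomorphic to a bound quiver algebra
`kQ / ⟨R⟩`, where `Q` is the cyclic quiver with `N ≥ 1` vertices and `R` is a nonempty finite set
of paths of length at least two. -/
def IsCyclicNakayama (k : Type u) [Field k] (Λ : Type v) [Ring Λ] [Algebra k Λ] : Prop :=
  ∃ (N : ℕ) (_ : NeZero N) (R : Finset (CPath N)), R.Nonempty ∧ (∀ p ∈ R, 2 ≤ p.length) ∧
    Nonempty (Λ ≃ₐ[k] BoundQuiverAlgebra k R)

lemma IsCyclicNakayama.isNoetherianRing {k : Type u} [Field k] {Λ : Type v} [Ring Λ] [Algebra k Λ]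
    (h : IsCyclicNakayama k Λ) : IsNoetherianRing Λ := by
  obtain ⟨N, _, R, hR, -, ⟨e⟩⟩ := h
  have := CyclicQuiver.BoundQuiverAlgebra.finite k R hR
  have : Module.Finite k Λ := Module.Finite.equiv e.symm.toLinearEquiv
  exact IsNoetherianRing.of_finite k Λ

end

/-!
A module over a cyclic Nakayama algebra is a direct sum of uniserial modules
(`uniserial_induction`), and a uniserial module is determined by its top and its length
(`IsGen.nonempty_equiv`). On the universal cover `ℤ` of the cyclic quiver it is an interval `[a, b)`
with `a ≤ b ≤ next a`, where `[a, next a)` is the indecomposable projective module of the vertex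
`a`. The function `next` is monotone and commutes with the shift by `N`. The syzygy of `[a, b)` is
`[b, next a)`, so the second syzygy is `[next a, next b)`.

As there are finitely many uniserial modules, the finitistic dimension `d` is finite
(`finDim_ne_top`). Let `t > d`, and consider the nonzero classes `L ^ t [U]` for uniserial `U`. They
are classes of uniserial modules, and taking syzygies maps this finite set of modules to itself,
as the class of a module of finite projective dimension is killed by `L ^ d` (`mapsTo_syz`). It is
injective there (`injOn_syz`): if distinct `t`-th syzygies `[next^[m] p, c)` and `[next^[m] q, c)`
have the same syzygy, then `next^[m + 1] p = next^[m + 1] q`, and the interval `[p, q)` has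
projective dimension `2 * m + 1 ≥ t`, a contradiction (`le_finDim_of_collision`). So taking syzygies
permutes these modules, some power of `L` is the identity on `L ^ t K₀`, and no rank drops after
the `t`-th step. With `t = d + 1` this bounds the `φ`-dimension by `d + 1`.

It suffices that the classes of uniserial modules span `K₀`; that they are linearly independent
(the Krull-Schmidt theorem) is not needed.
-/

noncomputable section

/-! ### Generators and relations of a cyclic Nakayama algebra -/

/-- What the proof uses of a cyclic Nakayama algebra: orthogonal idempotents `e i` for the vertices,
the sum `x` of all arrows, which is nilpotent, and the fact that the paths `x ^ s * e i` span the
algebra. That the nonzero ones among them are linearly independent is a consequence. -/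
structure CyclicPresentation (k : Type u) [Field k] (Λ : Type v) [Ring Λ] [Algebra k Λ]
    (N : ℕ) [NeZero N] where
  /-- The idempotent of a vertex. -/
  e : ZMod N → Λ
  /-- The sum of all arrows. -/
  x : Λ
  e_mul_e : ∀ i j, e i * e j = if i = j then e i else 0
  sum_e : ∑ i, e i = 1
  x_mul_e : ∀ i, x * e i = e (i + 1) * x
  nilpotent : IsNilpotent x
  span_eq_top : Submodule.span k (Set.range fun p : ℕ × ZMod N => x ^ p.1 * e p.2) = ⊤

namespace CyclicPresentation

open Polynomial

section Construction

variable {k : Type u} [Field k] {Λ : Type v} [Ring Λ] [Algebra k Λ] {N : ℕ} [NeZero N]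

open CyclicQuiver

lemma arrows_pow_mul_of (s : ℕ) (i : ZMod N) :
    (∑ j : ZMod N, PathAlgebra.of k (⟨j, 1⟩ : CPath N)) ^ s * PathAlgebra.of k ⟨i, 0⟩ =
      PathAlgebra.of k ⟨i, s⟩ := by
  induction s with
  | zero => rw [pow_zero, one_mul]
  | succ s ih =>
    rw [pow_succ', mul_assoc, ih, Finset.sum_mul,
      Finset.sum_eq_single (i + s) (fun j _ hj => ?_) (by simp)]
    · rw [PathAlgebra.of_mul_of, PathAlgebra.pathMul, if_pos rfl]
    · rw [PathAlgebra.of_mul_of, PathAlgebra.pathMul, if_neg (Ne.symm hj)]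

/-- A quotient of the path algebra in which some path vanishes has a cyclic presentation. -/
def ofSurjective (π : PathAlgebra k N →ₐ[k] Λ) (hπ : Function.Surjective π) (r : CPath N)
    (hr : π (PathAlgebra.of k r) = 0) : CyclicPresentation k Λ N where
  e i := π (PathAlgebra.of k ⟨i, 0⟩)
  x := π (∑ j : ZMod N, PathAlgebra.of k ⟨j, 1⟩)
  e_mul_e i j := by
    rw [← map_mul, PathAlgebra.of_mul_of, PathAlgebra.pathMul]
    by_cases h : i = j
    · subst h; simp
    · simp [h, Ne.symm h]
  sum_e := by rw [← map_sum, ← PathAlgebra.one_def, map_one]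
  x_mul_e i := by
    rw [← map_mul, ← map_mul]
    congr 1
    have h := arrows_pow_mul_of (k := k) 1 i
    rw [pow_one] at h
    rw [h, Finset.mul_sum, Finset.sum_eq_single i (fun j _ hj => ?_) (by simp)]
    · simp [PathAlgebra.of_mul_of, PathAlgebra.pathMul]
    · simp [PathAlgebra.of_mul_of, PathAlgebra.pathMul, hj]
  nilpotent := by
    refine ⟨r.length + N, ?_⟩
    rw [← map_pow, ← mul_one ((∑ j : ZMod N, PathAlgebra.of k (⟨j, 1⟩ : CPath N)) ^ _),
      PathAlgebra.one_def, Finset.mul_sum, map_sum]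
    refine Finset.sum_eq_zero fun i _ => ?_
    -- starting at `i`, the vertex `r.start` is reached after `t < N` steps
    obtain ⟨t, ht, hti⟩ : ∃ t < N, i + (t : ZMod N) = r.start :=
      ⟨(r.start - i).val, ZMod.val_lt _, by rw [ZMod.natCast_zmod_val]; abel⟩
    have h : PathAlgebra.of k r * PathAlgebra.of k ⟨i, t⟩ =
        PathAlgebra.of k ⟨i, t + r.length⟩ := by
      rw [PathAlgebra.of_mul_of, PathAlgebra.pathMul, if_pos hti]
    rw [show r.length + N = (N - t) + (t + r.length) by omega, pow_add, mul_assoc,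
      arrows_pow_mul_of, ← h, map_mul, map_mul, hr, zero_mul, mul_zero]
  span_eq_top := by
    rw [eq_top_iff]
    rintro y -
    obtain ⟨y, rfl⟩ := hπ y
    induction y using PathAlgebra.induction with
    | h0 => simp
    | hadd y z hy hz => rw [map_add]; exact add_mem hy hz
    | hof c p =>
      rw [map_smul]
      refine Submodule.smul_mem _ _ (Submodule.subset_span ⟨(p.length, p.start), ?_⟩)
      simp only
      rw [← map_pow, ← map_mul, arrows_pow_mul_of]

end Construction

variable {k : Type u} [Field k] {Λ : Type v} [Ring Λ] [Algebra k Λ] {N : ℕ} [NeZero N]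
variable (D : CyclicPresentation k Λ N)

lemma e_mul_self (i : ZMod N) : D.e i * D.e i = D.e i := by simp [D.e_mul_e]

lemma pow_mul_e (s : ℕ) (i : ZMod N) : D.x ^ s * D.e i = D.e (i + s) * D.x ^ s := by
  induction s with
  | zero => simp
  | succ s ih =>
    rw [pow_succ', mul_assoc, ih, ← mul_assoc, D.x_mul_e, mul_assoc, ← pow_succ',
      Nat.cast_succ, add_assoc]

lemma exists_aeval (a : Λ) (i : ZMod N) : ∃ p : k[X], a * D.e i = aeval D.x p * D.e i := by
  have h : a ∈ Submodule.span k (Set.range fun p : ℕ × ZMod N => D.x ^ p.1 * D.e p.2) := by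
    rw [D.span_eq_top]; trivial
  induction h using Submodule.span_induction with
  | mem a h =>
    obtain ⟨⟨s, j⟩, rfl⟩ := h
    by_cases hj : j = i
    · subst hj
      exact ⟨X ^ s, by simp [mul_assoc, D.e_mul_e]⟩
    · exact ⟨0, by simp [mul_assoc, D.e_mul_e, hj]⟩
  | zero => exact ⟨0, by simp⟩
  | add a b _ _ ha hb =>
    obtain ⟨p, hp⟩ := ha
    obtain ⟨q, hq⟩ := hb
    exact ⟨p + q, by rw [add_mul, hp, hq, map_add, add_mul]⟩
  | smul c a _ ha =>
    obtain ⟨p, hp⟩ := ha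
    exact ⟨c • p, by rw [smul_mul_assoc, hp, map_smul, smul_mul_assoc]⟩

lemma pow_mul_aeval (s : ℕ) (p : k[X]) : D.x ^ s * aeval D.x p = aeval D.x p * D.x ^ s := by
  rw [← aeval_X_pow (R := k), ← map_mul, ← map_mul, mul_comm]

lemma exists_pow_mul_e (i : ZMod N) : ∃ s, D.x ^ s * D.e i = 0 := by
  obtain ⟨m, hm⟩ := D.nilpotent
  exact ⟨m, by rw [hm, zero_mul]⟩

open Classical in
/-- The length of the longest nonzero path that starts at `i`, plus one; this is the length of the
indecomposable projective module of the vertex `i`. -/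
def len (i : ZMod N) : ℕ := Nat.find (D.exists_pow_mul_e i)

lemma pow_mul_e_eq_zero_iff {s : ℕ} {i : ZMod N} : D.x ^ s * D.e i = 0 ↔ D.len i ≤ s := by
  classical
  refine ⟨fun h => Nat.find_min' _ h, fun h => ?_⟩
  rw [← Nat.sub_add_cancel h, pow_add, mul_assoc]
  convert mul_zero _
  exact Nat.find_spec (D.exists_pow_mul_e i)

lemma len_le_succ (i : ZMod N) : D.len i ≤ D.len (i + 1) + 1 := by
  rw [← pow_mul_e_eq_zero_iff, pow_succ, mul_assoc, x_mul_e, ← mul_assoc,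
    D.pow_mul_e_eq_zero_iff.2 le_rfl, zero_mul]

/-- A multiple of the path `x ^ l * e i` is killed by every power of `x` that kills the path. -/
lemma pow_mul_mul_pow_mul_e (a : Λ) {s l : ℕ} {i : ZMod N} (h : D.len i ≤ s + l) :
    D.x ^ s * (a * (D.x ^ l * D.e i)) = 0 := by
  obtain ⟨p, hp⟩ := D.exists_aeval a (i + l)
  rw [D.pow_mul_e, ← mul_assoc a, hp, mul_assoc, ← D.pow_mul_e, ← mul_assoc, D.pow_mul_aeval,
    mul_assoc, ← mul_assoc (D.x ^ s), ← pow_add, D.pow_mul_e_eq_zero_iff.2 h, mul_zero]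

/-! ### Uniserial modules -/

section Modules

variable {M : Type*} [AddCommGroup M] [Module Λ M]

/-- `v` generates `M`, lives at the vertex `i`, and `l` is the least power of `x` that kills `v`.
So `M` is uniserial of length `l` with top at the vertex `i`. -/
structure IsGen (v : M) (i : ZMod N) (l : ℕ) : Prop where
  exists_smul : ∀ m : M, ∃ a : Λ, a • v = m
  e_smul : D.e i • v = v
  pow_smul : D.x ^ l • v = 0
  pow_smul_ne : ∀ s < l, D.x ^ s • v ≠ 0

lemma X_pow_dvd {v : M} {l : ℕ} (hv : ∀ s < l, D.x ^ s • v ≠ 0) {p : k[X]}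
    (hp : aeval D.x p • v = 0) : (X : k[X]) ^ l ∣ p := by
  by_cases h0 : p = 0
  · simp [h0]
  -- write `p = X ^ d * q` with `q` prime to `X`; then `q` acts invertibly, so `x ^ d` kills `v`
  obtain ⟨d, q, hq, rfl⟩ := WfDvdMonoid.max_power_factor h0 (irreducible_X (R := k))
  by_contra hd
  have hdl : d < l := by
    by_contra! h
    exact hd ((pow_dvd_pow _ h).trans (dvd_mul_right _ _))
  obtain ⟨m, hm⟩ := D.nilpotent
  obtain ⟨a, b, hab⟩ : IsCoprime q (X ^ m) :=
    ((irreducible_X.coprime_iff_not_dvd.2 hq).symm).pow_right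
  refine hv d hdl ?_
  have h1 : X ^ d = a * (X ^ d * q) + b * X ^ d * X ^ m := by linear_combination (-X ^ d) * hab
  have h2 : D.x ^ d = aeval D.x (X ^ d : k[X]) := by simp
  rw [h2, h1, map_add, map_mul, map_mul _ (b * X ^ d)]
  simp only [aeval_X_pow, hm, mul_zero, add_zero]
  rw [mul_smul, hp, smul_zero]

/-- The left ideal of the elements that kill a generator of the uniserial module of length `l` with
top at `i`. -/
def ideal (i : ZMod N) (l : ℕ) : Submodule Λ Λ :=
  Submodule.span Λ {1 - D.e i, D.x ^ l * D.e i}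

variable {D}

lemma mem_ideal_iff {i : ZMod N} {l : ℕ} {a : Λ} :
    a ∈ D.ideal i l ↔ ∃ b c, b * (1 - D.e i) + c * (D.x ^ l * D.e i) = a := by
  simp [ideal, Submodule.mem_span_pair]

lemma smul_eq_zero_iff {v : M} {i : ZMod N} {l : ℕ} (h1 : D.e i • v = v)
    (h2 : D.x ^ l • v = 0) (h3 : ∀ s < l, D.x ^ s • v ≠ 0) {a : Λ} :
    a • v = 0 ↔ a ∈ D.ideal i l := by
  rw [mem_ideal_iff]
  constructor
  · intro h
    obtain ⟨p, hp⟩ := D.exists_aeval a i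
    have h4 : aeval D.x p • v = 0 := by
      rw [← h1, ← mul_smul, ← hp, mul_smul, h1, h]
    obtain ⟨q, rfl⟩ := D.X_pow_dvd h3 h4
    refine ⟨a, aeval D.x q, ?_⟩
    rw [mul_comm, map_mul, aeval_X_pow, mul_assoc] at hp
    rw [← hp]; noncomm_ring
  · rintro ⟨b, c, rfl⟩
    rw [add_smul, mul_smul, mul_smul, mul_smul, sub_smul, one_smul, h1, h2]
    simp

/-- A uniserial module is determined by its top and its length. -/
lemma IsGen.nonempty_equiv {v : M} {i : ZMod N} {l : ℕ} (h : D.IsGen v i l) :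
    Nonempty ((Λ ⧸ D.ideal i l) ≃ₗ[Λ] M) := by
  have hk : LinearMap.ker (LinearMap.toSpanSingleton Λ M v) = D.ideal i l := by
    ext a
    rw [LinearMap.mem_ker, LinearMap.toSpanSingleton_apply,
      smul_eq_zero_iff h.e_smul h.pow_smul h.pow_smul_ne]
  exact ⟨(Submodule.quotEquivOfEq _ _ hk.symm).trans
    (LinearMap.quotKerEquivOfSurjective _ fun m => h.exists_smul m)⟩

lemma one_sub_mem (i : ZMod N) (l : ℕ) : 1 - D.e i ∈ D.ideal i l :=
  Submodule.subset_span (by simp)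

lemma pow_mem_ideal_iff {i : ZMod N} {l s : ℕ} (hl : l ≤ D.len i) :
    D.x ^ s ∈ D.ideal i l ↔ l ≤ s := by
  rw [mem_ideal_iff]
  constructor
  · rintro ⟨b, c, h⟩
    by_contra! hs
    have h1 : D.x ^ s * D.e i = c * (D.x ^ l * D.e i) := by
      rw [← h, add_mul, mul_assoc b, sub_mul, one_mul, e_mul_self, sub_self, mul_zero, zero_add,
        mul_assoc, mul_assoc, e_mul_self]
    have h2 : D.x ^ (D.len i - 1 - s) * (D.x ^ s * D.e i) = 0 := by
      rw [h1]; exact D.pow_mul_mul_pow_mul_e _ (by omega)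
    rw [← mul_assoc, ← pow_add, D.pow_mul_e_eq_zero_iff] at h2
    omega
  · intro h
    refine ⟨D.x ^ s, D.x ^ (s - l), ?_⟩
    rw [← mul_assoc, ← pow_add, Nat.sub_add_cancel h]
    noncomm_ring

lemma isGen_mk {i : ZMod N} {l : ℕ} (hl : l ≤ D.len i) :
    D.IsGen (Submodule.Quotient.mk 1 : Λ ⧸ D.ideal i l) i l where
  exists_smul m := by
    obtain ⟨a, rfl⟩ := Submodule.Quotient.mk_surjective _ m
    exact ⟨a, by rw [← Submodule.Quotient.mk_smul, smul_eq_mul, mul_one]⟩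
  e_smul := by
    rw [← Submodule.Quotient.mk_smul, smul_eq_mul, mul_one]
    exact ((Submodule.Quotient.eq _).2 (one_sub_mem i l)).symm
  pow_smul := by
    rw [← Submodule.Quotient.mk_smul, smul_eq_mul, mul_one, Submodule.Quotient.mk_eq_zero]
    exact (pow_mem_ideal_iff hl).2 le_rfl
  pow_smul_ne s hs := by
    rw [← Submodule.Quotient.mk_smul, smul_eq_mul, mul_one, Ne, Submodule.Quotient.mk_eq_zero,
      pow_mem_ideal_iff hl]
    omega

lemma IsGen.le_len {v : M} {i : ZMod N} {l : ℕ} (h : D.IsGen v i l) : l ≤ D.len i := by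
  by_contra! hl
  apply h.pow_smul_ne _ hl
  rw [← h.e_smul, ← mul_smul, D.pow_mul_e_eq_zero_iff.2 le_rfl, zero_smul]

lemma ideal_anti {i : ZMod N} {l m : ℕ} (h : l ≤ m) : D.ideal i m ≤ D.ideal i l := by
  rw [ideal, Submodule.span_le]
  rintro _ (rfl | rfl)
  · exact one_sub_mem i l
  · rw [← Nat.sub_add_cancel h, pow_add, mul_assoc]
    exact Submodule.smul_mem _ (D.x ^ (m - l)) (Submodule.subset_span (by simp))

variable (D) in
/-- The projective cover of the uniserial module of length `l` with top at `i`. -/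
def cover (i : ZMod N) (l : ℕ) (hl : l ≤ D.len i) :
    (Λ ⧸ D.ideal i (D.len i)) →ₗ[Λ] (Λ ⧸ D.ideal i l) :=
  Submodule.factor (ideal_anti hl)

lemma cover_surjective {i : ZMod N} {l : ℕ} (hl : l ≤ D.len i) :
    Function.Surjective (D.cover i l hl) :=
  Submodule.factor_surjective (ideal_anti hl)

lemma exists_isGen_ker_cover {i : ZMod N} {l : ℕ} (hl : l ≤ D.len i) :
    ∃ w : LinearMap.ker (D.cover i l hl), D.IsGen w (i + l) (D.len i - l) := by
  have hg := isGen_mk (D := D) (i := i) le_rfl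
  have hw : Submodule.Quotient.mk (D.x ^ l) ∈ LinearMap.ker (D.cover i l hl) :=
    (Submodule.Quotient.mk_eq_zero _).2 ((pow_mem_ideal_iff hl).2 le_rfl)
  have hw' : (Submodule.Quotient.mk (D.x ^ l) : Λ ⧸ D.ideal i (D.len i)) =
      D.x ^ l • Submodule.Quotient.mk 1 := by
    rw [← Submodule.Quotient.mk_smul, smul_eq_mul, mul_one]
  refine ⟨⟨_, hw⟩, ?_, ?_, ?_, ?_⟩
  · rintro ⟨m, hm⟩
    obtain ⟨a, rfl⟩ := Submodule.Quotient.mk_surjective _ m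
    have ha : a ∈ D.ideal i l := (Submodule.Quotient.mk_eq_zero _).1 hm
    obtain ⟨b, c, rfl⟩ := mem_ideal_iff.1 ha
    refine ⟨c, Subtype.ext ?_⟩
    rw [Submodule.coe_smul, ← Submodule.Quotient.mk_smul, Submodule.Quotient.eq, smul_eq_mul]
    have h : c * D.x ^ l - (b * (1 - D.e i) + c * (D.x ^ l * D.e i)) =
        (c * D.x ^ l - b) * (1 - D.e i) := by noncomm_ring
    rw [h]
    exact Submodule.smul_mem _ _ (one_sub_mem i _)
  · refine Subtype.ext ?_
    rw [Submodule.coe_smul]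
    simp only [hw']
    rw [← mul_smul, ← D.pow_mul_e, mul_smul, hg.e_smul]
  · refine Subtype.ext ?_
    rw [Submodule.coe_smul]
    simp only [hw']
    rw [← mul_smul, ← pow_add, Nat.sub_add_cancel hl, hg.pow_smul, ZeroMemClass.coe_zero]
  · intro s hs h
    rw [Subtype.ext_iff] at h
    rw [Submodule.coe_smul] at h
    simp only [hw'] at h
    rw [← mul_smul, ← pow_add] at h
    exact hg.pow_smul_ne _ (by omega) h

lemma projective_ideal_len (i : ZMod N) : Module.Projective Λ (Λ ⧸ D.ideal i (D.len i)) := by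
  have h : D.ideal i (D.len i) ≤ LinearMap.ker (LinearMap.toSpanSingleton Λ Λ (D.e i)) := by
    intro a ha
    obtain ⟨b, c, rfl⟩ := mem_ideal_iff.1 ha
    rw [D.pow_mul_e_eq_zero_iff.2 le_rfl, LinearMap.mem_ker, LinearMap.toSpanSingleton_apply,
      smul_eq_mul, mul_zero, add_zero, mul_assoc, sub_mul, e_mul_self, one_mul, sub_self, mul_zero]
  refine Module.Projective.of_split ((D.ideal i (D.len i)).liftQ _ h)
    (D.ideal i (D.len i)).mkQ ?_
  ext
  simp only [LinearMap.comp_apply, Submodule.mkQ_apply, LinearMap.id_apply,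
    Submodule.liftQ_apply, LinearMap.toSpanSingleton_apply, one_smul]
  exact ((Submodule.Quotient.eq _).2 (one_sub_mem i _)).symm

lemma not_projective {i : ZMod N} {l : ℕ} (h0 : 0 < l) (hl : l < D.len i) :
    ¬ Module.Projective Λ (Λ ⧸ D.ideal i l) := by
  intro hP
  obtain ⟨σ, hσ⟩ := Module.projective_lifting_property (D.ideal i l).mkQ LinearMap.id
    (Submodule.mkQ_surjective _)
  set w := σ (Submodule.Quotient.mk 1) with hw
  have h1 : (1 : Λ) - w ∈ D.ideal i l :=
    (Submodule.Quotient.eq _).1 (LinearMap.congr_fun hσ (Submodule.Quotient.mk 1)).symm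
  have h2 : D.x ^ l * w = 0 := by
    rw [hw, ← smul_eq_mul, ← map_smul, (isGen_mk hl.le).pow_smul, map_zero]
  obtain ⟨b, c, h3⟩ := mem_ideal_iff.1 h1
  -- the splitting produces `w = 1 - (element of the ideal)` killed by `x ^ l`, hence by
  -- `x ^ (len i - 1)`, which does not kill `e i`
  have h4 : w * D.e i = D.e i - c * (D.x ^ l * D.e i) := by
    have : w = 1 - (b * (1 - D.e i) + c * (D.x ^ l * D.e i)) := by rw [h3]; abel
    rw [this, sub_mul, one_mul, add_mul, mul_assoc b, sub_mul, one_mul, e_mul_self, sub_self,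
      mul_zero, zero_add, mul_assoc, mul_assoc, e_mul_self]
  have h5 : D.x ^ (D.len i - 1) * (w * D.e i) = 0 := by
    rw [show D.len i - 1 = (D.len i - 1 - l) + l by omega, pow_add, mul_assoc,
      ← mul_assoc _ w, h2, zero_mul, mul_zero]
  rw [h4, mul_sub, D.pow_mul_mul_pow_mul_e _ (by omega), sub_zero, D.pow_mul_e_eq_zero_iff] at h5
  omega

lemma subsingleton_iff {i : ZMod N} {l : ℕ} (hl : l ≤ D.len i) :
    Subsingleton (Λ ⧸ D.ideal i l) ↔ l = 0 := by
  rw [Submodule.Quotient.subsingleton_iff, Ideal.eq_top_iff_one, ← pow_zero D.x,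
    pow_mem_ideal_iff hl, Nat.le_zero]

/-- Every nonzero module has a uniserial direct summand: the submodule generated by an element `v`
at a vertex that is killed by as few powers of `x` as possible splits off. If `g` is a linear form
that is `1` on the socle element `x ^ (l - 1) v` and `0` on the other `x ^ s v`, then
`w ↦ ∑ g(e x ^ s w) x ^ (l - 1 - s) v` is a retraction, where `e` is the idempotent of the vertex
of the socle. -/
lemma exists_uniserial_summand [Module k M] [IsScalarTower k Λ M] [Nontrivial M]
    (D : CyclicPresentation k Λ N) :
    ∃ (i : ZMod N) (l : ℕ) (Y : Submodule Λ M), 0 < l ∧ l ≤ D.len i ∧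
      Nonempty (M ≃ₗ[Λ] ((Λ ⧸ D.ideal i l) × Y)) := by
  classical
  have : SMulCommClass k Λ M := IsScalarTower.to_smulCommClass
  have hex : ∃ l, ∀ m : M, D.x ^ l • m = 0 := by
    obtain ⟨n, hn⟩ := D.nilpotent
    exact ⟨n, fun m => by rw [hn, zero_smul]⟩
  obtain ⟨l, hl, hmin⟩ : ∃ l, (∀ m : M, D.x ^ (l + 1) • m = 0) ∧
      ∃ m : M, D.x ^ l • m ≠ 0 := by
    have h1 := Nat.find_spec hex
    obtain ⟨l, h2⟩ : ∃ l, Nat.find hex = l + 1 := by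
      refine Nat.exists_eq_succ_of_ne_zero fun h0 => ?_
      rw [h0] at h1
      obtain ⟨m, hm⟩ := exists_ne (0 : M)
      exact hm (by simpa using h1 m)
    rw [h2] at h1
    refine ⟨l, h1, ?_⟩
    by_contra! h
    have := Nat.find_min' hex h
    omega
  obtain ⟨m, hm⟩ := hmin
  obtain ⟨i, hi⟩ : ∃ i, D.x ^ l • D.e i • m ≠ 0 := by
    by_contra! h
    apply hm
    rw [← one_smul Λ m, ← D.sum_e, Finset.sum_smul, Finset.smul_sum]
    exact Finset.sum_eq_zero fun i _ => h i
  set v := D.e i • m with hv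
  have hev : D.e i • v = v := by rw [hv, ← mul_smul, e_mul_self]
  have hne : ∀ s < l + 1, D.x ^ s • v ≠ 0 := by
    intro s hs h
    apply hi
    rw [← Nat.sub_add_cancel (Nat.lt_succ_iff.1 hs), pow_add, mul_smul, h, smul_zero]
  clear_value v
  -- `g` exists, as `x ^ l v` is not a combination of the other `x ^ s v`
  obtain ⟨g, hg1, hg0⟩ : ∃ g : M →ₗ[k] k, g (D.x ^ l • v) = 1 ∧ ∀ s < l, g (D.x ^ s • v) = 0 := by
    have hnot : D.x ^ l • v ∉ Submodule.span k ((fun s => D.x ^ s • v) '' Set.Iio l) := by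
      intro h
      have key : ∀ y ∈ Submodule.span k ((fun s => D.x ^ s • v) '' Set.Iio l),
          ∃ p : k[X], p.coeff l = 0 ∧ y = aeval D.x p • v := by
        intro y hy
        induction hy using Submodule.span_induction with
        | mem y hy =>
          obtain ⟨s, hs, rfl⟩ := hy
          exact ⟨X ^ s, by rw [coeff_X_pow, if_neg (ne_of_gt hs)], by simp⟩
        | zero => exact ⟨0, by simp, by simp⟩
        | add y z _ _ hy hz =>
          obtain ⟨p, hp, rfl⟩ := hy
          obtain ⟨q, hq, rfl⟩ := hz
          exact ⟨p + q, by simp [hp, hq], by rw [map_add, add_smul]⟩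
        | smul c y _ hy =>
          obtain ⟨p, hp, rfl⟩ := hy
          exact ⟨c • p, by simp [hp], by rw [map_smul, smul_assoc]⟩
      obtain ⟨p, hp, h⟩ := key _ h
      have hd : (X : k[X]) ^ (l + 1) ∣ X ^ l - p :=
        D.X_pow_dvd hne (by rw [map_sub, sub_smul, aeval_X_pow, h, sub_self])
      have := X_pow_dvd_iff.1 hd l (by omega)
      simp [hp] at this
    obtain ⟨f, hf, hf0⟩ := Submodule.exists_dual_map_eq_bot_of_notMem hnot inferInstance
    refine ⟨(f (D.x ^ l • v))⁻¹ • f, by simp [hf], fun s hs => ?_⟩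
    have : f (D.x ^ s • v) ∈ Submodule.map f
        (Submodule.span k ((fun s => D.x ^ s • v) '' Set.Iio l)) :=
      Submodule.mem_map_of_mem (Submodule.subset_span ⟨s, hs, rfl⟩)
    rw [hf0, Submodule.mem_bot] at this
    simp [this]
  let ρ : M → M := fun w =>
    ∑ s ∈ Finset.range (l + 1), g (D.e (i + l) • D.x ^ s • w) • D.x ^ (l - s) • v
  have hadd : ∀ w w', ρ (w + w') = ρ w + ρ w' := by
    intro w w'
    simp only [ρ, smul_add, map_add, add_smul, Finset.sum_add_distrib]
  have hρx : ∀ w, ρ (D.x • w) = D.x • ρ w := by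
    intro w
    simp only [ρ]
    rw [Finset.sum_range_succ, Finset.smul_sum, Finset.sum_range_succ', ← mul_smul (D.x ^ l),
      ← pow_succ, hl, smul_zero, map_zero, zero_smul, add_zero]
    rw [smul_comm D.x, ← mul_smul D.x (D.x ^ (l - 0)), ← pow_succ', Nat.sub_zero, hl, smul_zero,
      add_zero]
    refine Finset.sum_congr rfl fun s hs => ?_
    rw [smul_comm D.x, ← mul_smul D.x (D.x ^ _), ← pow_succ', ← mul_smul (D.x ^ s), ← pow_succ,
      show l - (s + 1) + 1 = l - s by have := Finset.mem_range.1 hs; omega]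
  have hρe : ∀ j w, ρ (D.e j • w) = D.e j • ρ w := by
    intro j w
    simp only [ρ]
    rw [Finset.smul_sum]
    refine Finset.sum_congr rfl fun s hs => ?_
    have hs' : s ≤ l := Nat.lt_succ_iff.1 (Finset.mem_range.1 hs)
    have h1 : D.x ^ (l - s) • v = D.e (i + (l - s : ℕ)) • D.x ^ (l - s) • v := by
      rw [← mul_smul, ← D.pow_mul_e, mul_smul, hev]
    rw [smul_comm (D.e j), h1, ← mul_smul (D.x ^ s), D.pow_mul_e, mul_smul,
      ← mul_smul (D.e (i + l)), ← mul_smul (D.e j), D.e_mul_e, D.e_mul_e]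
    have h2 : i + (l : ZMod N) = j + s ↔ j = i + (l - s : ℕ) := by
      rw [Nat.cast_sub hs', eq_comm, ← add_sub_assoc, eq_sub_iff_add_eq]
    by_cases hj : j = i + (l - s : ℕ)
    · rw [if_pos (h2.2 hj), if_pos hj, hj]
    · rw [if_neg (mt h2.1 hj), if_neg hj, zero_smul, zero_smul, map_zero, zero_smul, smul_zero]
  have hρk : ∀ (c : k) w, ρ (c • w) = c • ρ w := by
    intro c w
    simp only [ρ]
    rw [Finset.smul_sum]
    refine Finset.sum_congr rfl fun s _ => ?_
    rw [smul_comm (D.x ^ s), smul_comm (D.e _) c, map_smul, smul_assoc]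
  have hρ : ∀ (a : Λ) w, ρ (a • w) = a • ρ w := by
    intro a
    have h : a ∈ Submodule.span k (Set.range fun p : ℕ × ZMod N => D.x ^ p.1 * D.e p.2) := by
      rw [D.span_eq_top]; trivial
    induction h using Submodule.span_induction with
    | mem a h =>
      obtain ⟨⟨s, j⟩, rfl⟩ := h
      simp only
      induction s with
      | zero => intro w; rw [pow_zero, one_mul, hρe]
      | succ s ih => intro w; rw [pow_succ', mul_assoc, mul_smul, hρx, ih, ← mul_smul]
    | zero => intro w; simp [ρ]
    | add a b _ _ ha hb => intro w; rw [add_smul, hadd, ha, hb, add_smul]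
    | smul c a _ ha => intro w; rw [smul_assoc, hρk, ha, smul_assoc]
  have hρv : ρ v = v := by
    simp only [ρ]
    rw [Finset.sum_range_succ, Finset.sum_eq_zero, zero_add, ← mul_smul (D.e _), ← D.pow_mul_e,
      mul_smul, hev, hg1, Nat.sub_self, pow_zero, one_smul, one_smul]
    intro s hs
    rw [← hev, ← mul_smul (D.x ^ s), D.pow_mul_e, mul_smul, ← mul_smul (D.e (i + l)), D.e_mul_e]
    split_ifs with h
    · rw [h, ← mul_smul, ← D.pow_mul_e, mul_smul, hev, hg0 s (Finset.mem_range.1 hs), zero_smul]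
    · rw [zero_smul, map_zero, zero_smul]
  have hmem : ∀ w, ρ w ∈ Submodule.span Λ {v} := by
    intro w
    refine Submodule.sum_mem _ fun s _ => ?_
    rw [← smul_assoc]
    exact Submodule.smul_mem _ _ (Submodule.mem_span_singleton_self v)
  let r : M →ₗ[Λ] Submodule.span Λ {v} :=
    { toFun := fun w => ⟨ρ w, hmem w⟩
      map_add' := fun w w' => Subtype.ext (hadd w w')
      map_smul' := fun a w => Subtype.ext (hρ a w) }
  have hr : ∀ w : Submodule.span Λ {v}, r w = w := by
    rintro ⟨w, hw⟩
    obtain ⟨a, rfl⟩ := Submodule.mem_span_singleton.1 hw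
    exact Subtype.ext (by change ρ (a • v) = a • v; rw [hρ, hρv])
  have hgen : D.IsGen (⟨v, Submodule.mem_span_singleton_self v⟩ : Submodule.span Λ {v}) i
      (l + 1) := by
    refine ⟨?_, Subtype.ext hev, Subtype.ext (hl v), fun s hs h => hne s hs (Subtype.ext_iff.1 h)⟩
    rintro ⟨w, hw⟩
    obtain ⟨a, rfl⟩ := Submodule.mem_span_singleton.1 hw
    exact ⟨a, rfl⟩
  obtain ⟨φ⟩ := hgen.nonempty_equiv
  refine ⟨i, l + 1, LinearMap.ker r, Nat.succ_pos l, hgen.le_len, ⟨?_⟩⟩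
  exact (Submodule.prodEquivOfIsCompl _ _ (LinearMap.isCompl_of_proj hr)).symm.trans
    (φ.symm.prodCongr (LinearEquiv.refl Λ _))

end Modules

end CyclicPresentation

/-! ### Projective dimension of modules -/

section ProjectiveDimension

variable {A : Type v} [Ring A]

lemma hasProjectiveDimensionLT_iff_of_linearEquiv {X Y : Type v} [AddCommGroup X] [Module A X]
    [AddCommGroup Y] [Module A Y] (e : X ≃ₗ[A] Y) (n : ℕ) :
    HasProjectiveDimensionLT (ModuleCat.of A X) n ↔
      HasProjectiveDimensionLT (ModuleCat.of A Y) n :=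
  ⟨fun _ => hasProjectiveDimensionLT_of_iso e.toModuleIso n,
    fun _ => hasProjectiveDimensionLT_of_iso e.toModuleIso.symm n⟩

lemma hasProjectiveDimensionLT_prod_iff (X Y : Type v) [AddCommGroup X] [Module A X]
    [AddCommGroup Y] [Module A Y] (n : ℕ) :
    HasProjectiveDimensionLT (ModuleCat.of A (X × Y)) n ↔
      HasProjectiveDimensionLT (ModuleCat.of A X) n ∧
        HasProjectiveDimensionLT (ModuleCat.of A Y) n := by
  refine ⟨fun h => ⟨?_, ?_⟩, fun ⟨h1, h2⟩ => ?_⟩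
  · exact Retract.hasProjectiveDimensionLT (Y := ModuleCat.of A (X × Y))
      ⟨ModuleCat.ofHom (LinearMap.inl A X Y), ModuleCat.ofHom (LinearMap.fst A X Y), by
        rw [← ModuleCat.ofHom_comp, LinearMap.fst_comp_inl]; rfl⟩ n
  · exact Retract.hasProjectiveDimensionLT (Y := ModuleCat.of A (X × Y))
      ⟨ModuleCat.ofHom (LinearMap.inr A X Y), ModuleCat.ofHom (LinearMap.snd A X Y), by
        rw [← ModuleCat.ofHom_comp, LinearMap.snd_comp_inr]; rfl⟩ n
  · exact hasProjectiveDimensionLT_of_iso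
      (ModuleCat.biprodIsoProd (ModuleCat.of A X) (ModuleCat.of A Y)) n

lemma hasProjectiveDimensionLT_ker_iff {P M : Type v} [AddCommGroup P] [Module A P]
    [AddCommGroup M] [Module A M] (hP : Module.Projective A P) (f : P →ₗ[A] M)
    (hf : Function.Surjective f) (n : ℕ) :
    HasProjectiveDimensionLT (ModuleCat.of A M) (n + 2) ↔
      HasProjectiveDimensionLT (ModuleCat.of A (LinearMap.ker f)) (n + 1) := by
  have hS : (ModuleCat.shortComplexOfCompEqZero (LinearMap.ker f).subtype f
      (LinearMap.comp_ker_subtype f)).ShortExact :=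
    ModuleCat.shortComplex_shortExact _ (LinearMap.exact_subtype_ker_map f)
      (Submodule.subtype_injective _) hf
  exact hS.hasProjectiveDimensionLT_X₃_iff n ((IsProjective.iff_projective P).1 hP)

lemma projectiveDimension_eq_natCast_iff {C : Type*} [Category* C] [Abelian C] (X : C) (n : ℕ) :
    projectiveDimension X = n ↔
      HasProjectiveDimensionLT X (n + 1) ∧ ¬ HasProjectiveDimensionLT X n := by
  rw [le_antisymm_iff, projectiveDimension_le_iff, projectiveDimension_ge_iff]

end ProjectiveDimension

/-! ### The group `K₀` of a Noetherian ring -/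

namespace Homological

variable {A : Type v} [Ring A]

lemma cls_of_subsingleton (M : FGModuleCat.{v} A) [Subsingleton M] : cls M = 0 :=
  cls_proj M Module.Projective.of_free

lemma cls_eq_of_equiv {M X : FGModuleCat.{v} A} (e : M ≃ₗ[A] X) : cls M = cls X := by
  rw [cls_sum (Y := FGModuleCat.of A PUnit) (e.trans LinearEquiv.prodUnique.symm)]
  have : Subsingleton (FGModuleCat.of A PUnit.{v + 1}) := inferInstanceAs (Subsingleton PUnit)
  rw [cls_of_subsingleton (FGModuleCat.of A PUnit), add_zero]

/-- If `L` is injective on `L ^ t K₀`, then no rank drops after the `t`-th step. -/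
lemma phi_le_of_injOn [IsNoetherianRing A] {t : ℕ}
    (h : Set.InjOn (L A) (LinearMap.range (L A ^ t))) (M : FGModuleCat.{v} A) : phi M ≤ t := by
  refine Nat.sInf_le fun j _ => ?_
  have hj : ∀ j : ℕ, Set.InjOn (L A ^ j) (LinearMap.range (L A ^ t)) := by
    intro j
    induction j with
    | zero => intro x _ y _ hxy; simpa using hxy
    | succ j ih =>
      rw [pow_succ, Module.End.mul_eq_comp, LinearMap.coe_comp]
      refine ih.comp h ?_
      rintro _ ⟨y, rfl⟩
      exact ⟨L A y, by rw [← Module.End.mul_apply, ← Module.End.mul_apply, ← pow_succ, ← pow_succ']⟩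
  have hle : (addSpan M).map (L A ^ t) ≤ LinearMap.range (L A ^ t) := LinearMap.map_le_range
  rw [rankL, rankL, add_comm t j, pow_add, Module.End.mul_eq_comp, Submodule.map_comp]
  have hinj : Function.Injective ((L A ^ j).domRestrict ((addSpan M).map (L A ^ t))) := by
    intro x y hxy
    exact Subtype.ext (hj j (hle x.2) (hle y.2) hxy)
  rw [(LinearEquiv.ofInjective _ hinj).finrank_eq, LinearMap.range_domRestrict]

end Homological

/-! ### Uniserial modules in `K₀` -/

namespace CyclicPresentation

open Homological

variable {k : Type u} [Field k] {Λ : Type v} [Ring Λ] [Algebra k Λ] {N : ℕ} [NeZero N]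
variable (D : CyclicPresentation k Λ N)

/-- The uniserial module with top `u.1` and length `u.2`, if `u.2 ≤ D.len u.1`. -/
def uniserial (u : ZMod N × ℕ) : FGModuleCat.{v} Λ := FGModuleCat.of Λ (Λ ⧸ D.ideal u.1 u.2)

/-- The top and the length of the first syzygy of a uniserial module. -/
def syz (u : ZMod N × ℕ) : ZMod N × ℕ := (u.1 + u.2, D.len u.1 - u.2)

/-- The tops and lengths of the uniserial modules, including the zero modules. -/
def Valid (u : ZMod N × ℕ) : Prop := u.2 ≤ D.len u.1

/-- The tops and lengths of the nonprojective uniserial modules. -/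
def Proper (u : ZMod N × ℕ) : Prop := 0 < u.2 ∧ u.2 < D.len u.1

lemma finite_valid : {u | D.Valid u}.Finite := by
  refine ((Set.finite_univ (α := ZMod N)).prod
    (Set.finite_Iic (∑ i, D.len i))).subset fun u hu => ⟨trivial, ?_⟩
  exact (show u.2 ≤ D.len u.1 from hu).trans
    (Finset.single_le_sum (f := D.len) (fun _ _ => Nat.zero_le _) (Finset.mem_univ _))

variable {D}

lemma Proper.valid {u : ZMod N × ℕ} (h : D.Proper u) : D.Valid u := h.2.le

lemma nonempty_ker_cover_equiv {u : ZMod N × ℕ} (hu : D.Valid u) :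
    Nonempty (LinearMap.ker (D.cover u.1 u.2 hu) ≃ₗ[Λ] D.uniserial (D.syz u)) := by
  obtain ⟨w, hw⟩ := exists_isGen_ker_cover hu
  obtain ⟨φ⟩ := hw.nonempty_equiv
  exact ⟨φ.symm⟩

lemma hasProjectiveDimensionLT_syz_iff {u : ZMod N × ℕ} (hu : D.Valid u) (n : ℕ) :
    HasProjectiveDimensionLT (D.uniserial u).obj (n + 2) ↔
      HasProjectiveDimensionLT (D.uniserial (D.syz u)).obj (n + 1) := by
  obtain ⟨φ⟩ := nonempty_ker_cover_equiv hu
  exact (hasProjectiveDimensionLT_ker_iff (projective_ideal_len u.1) _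
    (cover_surjective hu) n).trans (hasProjectiveDimensionLT_iff_of_linearEquiv φ _)

lemma projective_uniserial {u : ZMod N × ℕ} (hu : D.Valid u) (h : ¬ D.Proper u) :
    Module.Projective Λ (D.uniserial u) := by
  by_cases h0 : u.2 = 0
  · have : Subsingleton (Λ ⧸ D.ideal u.1 u.2) := (subsingleton_iff hu).2 h0
    exact Module.Projective.of_free (R := Λ) (P := Λ ⧸ D.ideal u.1 u.2)
  · have hl : u.2 = D.len u.1 := le_antisymm hu (by
      by_contra! h1
      exact h ⟨Nat.pos_of_ne_zero h0, h1⟩)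
    have := projective_ideal_len (D := D) u.1
    rw [← hl] at this
    exact this

/-- If the syzygies of a uniserial module are not projective before the `n`-th one, which is
projective and not zero, then the projective dimension is `n`. -/
lemma projectiveDimension_uniserial {n : ℕ} {u : ZMod N × ℕ} (hu : D.Valid u)
    (h : ∀ s < n, D.Proper (D.syz^[s] u)) (h0 : 0 < (D.syz^[n] u).2)
    (hn : (D.syz^[n] u).2 = D.len (D.syz^[n] u).1) :
    projectiveDimension (D.uniserial u).obj = n := by
  rw [projectiveDimension_eq_natCast_iff]
  induction n generalizing u with
  | zero =>
    rw [zero_add, ← projective_iff_hasProjectiveDimensionLT_one,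
      hasProjectiveDimensionLT_zero_iff_isZero, ModuleCat.isZero_iff_subsingleton]
    refine ⟨(IsProjective.iff_projective (D.uniserial u)).1
      (projective_uniserial hu fun h' => h'.2.ne hn), fun hz => ?_⟩
    exact h0.ne' ((subsingleton_iff hu).1 hz)
  | succ n ih =>
    have hp : D.Proper u := h 0 n.succ_pos
    have hv : D.Valid (D.syz u) := by
      obtain _ | m := n
      · exact hn.le
      · exact (h 1 (by omega)).valid
    obtain ⟨h1, h2⟩ := ih hv (fun s hs => h (s + 1) (by omega)) h0 hn
    refine ⟨(hasProjectiveDimensionLT_syz_iff hu n).2 h1, ?_⟩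
    obtain _ | m := n
    · rw [zero_add, ← projective_iff_hasProjectiveDimensionLT_one]
      exact fun h' => not_projective hp.1 hp.2
        ((IsProjective.iff_projective (D.uniserial u)).2 h')
    · rwa [hasProjectiveDimensionLT_syz_iff hu m]

lemma le_finDim {n : ℕ} {u : ZMod N × ℕ} (hu : D.Valid u)
    (h : ∀ s < n, D.Proper (D.syz^[s] u)) (h0 : 0 < (D.syz^[n] u).2)
    (hn : (D.syz^[n] u).2 = D.len (D.syz^[n] u).1) : (n : ℕ∞) ≤ finDim Λ :=
  le_iSup₂_of_le n ⟨D.uniserial u, projectiveDimension_uniserial hu h h0 hn⟩ le_rfl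

lemma cls_uniserial_eq_zero {u : ZMod N × ℕ} (hu : D.Valid u) (h : ¬ D.Proper u) :
    cls (D.uniserial u) = 0 :=
  cls_proj _ (projective_uniserial hu h)

lemma L_cls_uniserial [IsNoetherianRing Λ] {u : ZMod N × ℕ} (hu : D.Valid u) :
    L Λ (cls (D.uniserial u)) = cls (D.uniserial (D.syz u)) := by
  obtain ⟨φ⟩ := nonempty_ker_cover_equiv hu
  have := projective_ideal_len (D := D) u.1
  exact (L_cls (D.uniserial u) (D.cover u.1 u.2 hu) (cover_surjective hu)).trans
    (cls_eq_of_equiv φ)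

/-- Every finitely generated module is a finite direct sum of uniserial modules, stated as an
induction principle. -/
lemma uniserial_induction [Module.Finite k Λ] [IsNoetherianRing Λ] (D : CyclicPresentation k Λ N)
    {motive : FGModuleCat.{v} Λ → Prop} (zero : ∀ M : FGModuleCat.{v} Λ, Subsingleton M → motive M)
    (prod : ∀ (M Y : FGModuleCat.{v} Λ) (u : ZMod N × ℕ), D.Valid u →
      (M ≃ₗ[Λ] (D.uniserial u × Y)) → motive Y → motive M) (M : FGModuleCat.{v} Λ) :
    motive M := by
  have key : ∀ (n : ℕ) (M : Type v) [AddCommGroup M] [Module Λ M] [Module k M]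
      [IsScalarTower k Λ M] [Module.Finite Λ M], Module.finrank k M = n →
      motive (FGModuleCat.of Λ M) := by
    intro n
    induction n using Nat.strong_induction_on with
    | _ n ih =>
      intro M _ _ _ _ _ hM
      obtain hs | hn := subsingleton_or_nontrivial M
      · exact zero _ hs
      obtain ⟨i, l, Y, hl, hil, ⟨e⟩⟩ := exists_uniserial_summand D (M := M)
      refine prod (FGModuleCat.of Λ M) (FGModuleCat.of Λ Y) (i, l) hil e (ih _ ?_ Y rfl)
      have : Module.Finite k M := Module.Finite.trans Λ M
      have : Module.Finite k Y := Module.Finite.trans Λ Y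
      have : Module.Finite k (Λ ⧸ D.ideal i l) := Module.Finite.trans Λ _
      have : Nontrivial (Λ ⧸ D.ideal i l) := by
        rw [← not_subsingleton_iff_nontrivial, subsingleton_iff hil]
        exact hl.ne'
      rw [← hM, (e.restrictScalars k).finrank_eq, Module.finrank_prod]
      have := Module.finrank_pos (R := k) (M := Λ ⧸ D.ideal i l)
      omega
  let _ : Module k M := Module.compHom M (algebraMap k Λ)
  have : IsScalarTower k Λ M := ⟨fun c a m => by
    rw [Algebra.smul_def, mul_smul]; rfl⟩
  exact key _ M rfl

lemma cls_mem_span [Module.Finite k Λ] [IsNoetherianRing Λ] (D : CyclicPresentation k Λ N)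
    (M : FGModuleCat.{v} Λ) :
    cls M ∈ Submodule.span ℤ ((fun u => cls (D.uniserial u)) '' {u | D.Valid u}) := by
  induction M using D.uniserial_induction with
  | zero M h => rw [cls_of_subsingleton]; exact zero_mem _
  | prod M Y u hu e hY =>
    rw [cls_sum e]
    exact add_mem (Submodule.subset_span ⟨u, hu, rfl⟩) hY

lemma span_cls_uniserial [Module.Finite k Λ] [IsNoetherianRing Λ] (D : CyclicPresentation k Λ N) :
    Submodule.span ℤ ((fun u => cls (D.uniserial u)) '' {u | D.Valid u}) = ⊤ := by
  rw [eq_top_iff]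
  rintro x -
  obtain ⟨x, rfl⟩ := Submodule.Quotient.mk_surjective _ x
  induction x using Finsupp.induction_linear with
  | zero => rw [Submodule.Quotient.mk_zero]; exact zero_mem _
  | add x y hx hy => rw [Submodule.Quotient.mk_add]; exact add_mem hx hy
  | single M c =>
    rw [← mul_one c, ← smul_eq_mul, ← Finsupp.smul_single, Submodule.Quotient.mk_smul]
    exact Submodule.smul_mem _ _ (D.cls_mem_span M)

/-- There are only finitely many uniserial modules, so the finite projective dimensions are
bounded. -/
lemma finDim_ne_top [Module.Finite k Λ] [IsNoetherianRing Λ] (D : CyclicPresentation k Λ N) :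
    finDim Λ ≠ ⊤ := by
  obtain ⟨b, hb⟩ : ∃ b : ℕ, ∀ u, D.Valid u →
      ∀ n, HasProjectiveDimensionLT (D.uniserial u).obj n →
        HasProjectiveDimensionLT (D.uniserial u).obj b := by
    have h : ∀ u, ∃ b : ℕ, ∀ n, HasProjectiveDimensionLT (D.uniserial u).obj n →
        HasProjectiveDimensionLT (D.uniserial u).obj b := fun u => by
      by_cases hn : ∃ n, HasProjectiveDimensionLT (D.uniserial u).obj n
      · exact ⟨hn.choose, fun _ _ => hn.choose_spec⟩
      · exact ⟨0, fun n h' => absurd ⟨n, h'⟩ hn⟩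
    choose b hb using h
    obtain ⟨B, hB⟩ := (D.finite_valid.image b).bddAbove
    refine ⟨B, fun u hu n hn => ?_⟩
    have := hb u n hn
    exact hasProjectiveDimensionLT_of_ge _ (b u) B (hB ⟨u, hu, rfl⟩)
  have key : ∀ (n : ℕ) (M : FGModuleCat.{v} Λ), HasProjectiveDimensionLT M.obj n →
      HasProjectiveDimensionLT M.obj b := by
    intro n M
    induction M using D.uniserial_induction with
    | zero M h =>
      intro _
      have : HasProjectiveDimensionLT M.obj 0 :=
        (hasProjectiveDimensionLT_zero_iff_isZero _).2 ((ModuleCat.isZero_iff_subsingleton).2 h)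
      exact hasProjectiveDimensionLT_of_ge _ 0 b (Nat.zero_le _)
    | prod M Y u hu e hY =>
      intro h
      obtain ⟨h1, h2⟩ := (hasProjectiveDimensionLT_prod_iff (D.uniserial u) Y n).1
        ((hasProjectiveDimensionLT_iff_of_linearEquiv e n).1 h)
      exact (hasProjectiveDimensionLT_iff_of_linearEquiv e b).2
        ((hasProjectiveDimensionLT_prod_iff (D.uniserial u) Y b).2 ⟨hb u hu n h1, hY h2⟩)
  refine ne_top_of_le_ne_top (ENat.natCast_ne_top b) (iSup₂_le fun n ⟨M, hM⟩ => ?_)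
  rw [projectiveDimension_eq_natCast_iff] at hM
  have := key _ M hM.1
  by_contra! hlt
  exact hM.2 (hasProjectiveDimensionLT_of_ge _ b n (by exact_mod_cast hlt.le))

end CyclicPresentation

/-! ### Syzygies as intervals of integers -/

namespace CyclicPresentation

open Homological

variable {k : Type u} [Field k] {Λ : Type v} [Ring Λ] [Algebra k Λ] {N : ℕ} [NeZero N]
variable (D : CyclicPresentation k Λ N)

/-- On the universal cover `ℤ` of the cyclic quiver, the first vertex that the indecomposable
projective module of the vertex `a` does not reach. -/
def next (a : ℤ) : ℤ := a + D.len a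

lemma next_mono : Monotone D.next := by
  refine monotone_int_of_le_succ fun a => ?_
  have := D.len_le_succ a
  rw [next, next]
  push_cast
  omega

lemma next_add_mul (a z : ℤ) : D.next (a + N * z) = D.next a + N * z := by
  simp [next]
  ring

/-- The uniserial module that lives on the vertices `a, a + 1, …, b - 1`: its top is at `a`, and
its length is `b - a`. -/
def interval (a b : ℤ) : ZMod N × ℕ := (a, (b - a).toNat)

/-- The endpoints of the syzygies of the interval `[a, b)`: as the first syzygy of `[a, b)` is
`[b, next a)`, the `n`-th one is `[endpoint a b n, endpoint a b (n + 1))`. -/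
def endpoint (a b : ℤ) : ℕ → ℤ
  | 0 => a
  | 1 => b
  | n + 2 => D.next (endpoint a b n)

lemma endpoint_succ (a b : ℤ) (n : ℕ) :
    D.endpoint a b (n + 1) = D.endpoint b (D.next a) n := by
  induction n using Nat.twoStepInduction with
  | zero => rfl
  | one => rfl
  | more n h _ => rw [endpoint, endpoint, h]

lemma endpoint_add_mul (a b z : ℤ) (n : ℕ) :
    D.endpoint (a + N * z) (b + N * z) n = D.endpoint a b n + N * z := by
  induction n using Nat.twoStepInduction with
  | zero => rfl
  | one => rfl
  | more n h _ => rw [endpoint, endpoint, h, next_add_mul]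

lemma endpoint_two_mul (a b : ℤ) (n : ℕ) : D.endpoint a b (2 * n) = D.next^[n] a := by
  induction n with
  | zero => rfl
  | succ n ih => rw [Nat.mul_succ, endpoint, ih, Function.iterate_succ_apply']

lemma endpoint_two_mul_add_one (a b : ℤ) (n : ℕ) :
    D.endpoint a b (2 * n + 1) = D.next^[n] b := by
  rw [endpoint_succ, endpoint_two_mul]

variable {D}

lemma valid_interval {a b : ℤ} (hb : b ≤ D.next a) : D.Valid (interval a b) := by
  rw [next] at hb
  simp only [Valid, interval]
  omega

lemma proper_interval_iff {a b : ℤ} : D.Proper (interval a b) ↔ a < b ∧ b < D.next a := by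
  rw [next]
  simp only [Proper, interval]
  omega

lemma exists_eq_interval {u : ZMod N × ℕ} (hu : D.Valid u) :
    ∃ a b : ℤ, a ≤ b ∧ b ≤ D.next a ∧ u = interval a b := by
  obtain ⟨i, l⟩ := u
  obtain ⟨a, rfl⟩ := ZMod.intCast_surjective i
  refine ⟨a, a + l, by omega, ?_, by simp [interval]⟩
  rw [next]
  have : l ≤ D.len a := hu
  omega

lemma syz_interval {a b : ℤ} (hab : a ≤ b) :
    D.syz (interval a b) = interval b (D.next a) := by
  refine Prod.ext ?_ ?_
  · simp only [syz, interval]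
    have : (((b - a).toNat : ℤ) : ZMod N) = ((b - a : ℤ) : ZMod N) := by
      rw [Int.toNat_of_nonneg (by omega)]
    rw [Int.cast_natCast] at this
    rw [this]; push_cast; ring
  · simp only [syz, interval, next]
    omega

lemma iterate_syz_interval {a b : ℤ} (hab : a ≤ b) (hb : b ≤ D.next a) (n : ℕ) :
    D.syz^[n] (interval a b) = interval (D.endpoint a b n) (D.endpoint a b (n + 1)) := by
  induction n generalizing a b with
  | zero => rfl
  | succ n ih =>
    rw [Function.iterate_succ_apply, syz_interval hab, ih hb (D.next_mono hab),
      D.endpoint_succ a b n, D.endpoint_succ a b (n + 1)]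

/-- If the intervals `[next^[m] p, c)` and `[next^[m] q, c)` are distinct and have the same syzygy,
then `[p, q)` has projective dimension `2 * m + 1`: its syzygies have the endpoints
`p < q < next p < next q < ⋯ < next^[m] q < next^[m + 1] p = next^[m + 1] q`. -/
lemma le_finDim_of_collision {p q : ℤ} {m : ℕ} (h1 : D.next^[m] p < D.next^[m] q)
    (h2 : D.next^[m] q < D.next^[m + 1] p) (h3 : D.next^[m + 1] p = D.next^[m + 1] q) :
    ((2 * m + 1 : ℕ) : ℕ∞) ≤ finDim Λ := by
  have h1' : ∀ j ≤ m, D.next^[j] p < D.next^[j] q := by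
    intro j hj
    by_contra! h
    have := D.next_mono.iterate (m - j) h
    rw [← Function.iterate_add_apply, ← Function.iterate_add_apply, Nat.sub_add_cancel hj] at this
    omega
  have h2' : ∀ j ≤ m, D.next^[j] q < D.next^[j + 1] p := by
    intro j hj
    by_contra! h
    have := D.next_mono.iterate (m - j) h
    rw [← Function.iterate_add_apply, ← Function.iterate_add_apply, ← add_assoc,
      Nat.sub_add_cancel hj] at this
    omega
  have hpq : p ≤ q := (h1' 0 m.zero_le).le
  have hqp : q ≤ D.next p := (h2' 0 m.zero_le).le
  have hlt : ∀ n ≤ 2 * m + 1, D.endpoint p q n < D.endpoint p q (n + 1) := by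
    intro n hn
    obtain ⟨j, rfl | rfl⟩ := n.even_or_odd'
    · rw [endpoint_two_mul, endpoint_two_mul_add_one]
      exact h1' j (by omega)
    · rw [endpoint_two_mul_add_one, show 2 * j + 1 + 1 = 2 * (j + 1) by omega, endpoint_two_mul]
      exact h2' j (by omega)
  have heq : D.endpoint p q (2 * m + 1 + 1) = D.next (D.endpoint p q (2 * m + 1)) := by
    rw [endpoint_two_mul_add_one, show 2 * m + 1 + 1 = 2 * (m + 1) by omega, endpoint_two_mul, h3,
      Function.iterate_succ_apply']
  refine le_finDim (valid_interval hqp) (fun s hs => ?_) ?_ ?_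
  · rw [iterate_syz_interval hpq hqp, proper_interval_iff]
    exact ⟨hlt s (by omega), hlt (s + 1) (by omega)⟩
  · rw [iterate_syz_interval hpq hqp]
    have := hlt (2 * m + 1) le_rfl
    simp only [interval]
    omega
  · rw [iterate_syz_interval hpq hqp, heq]
    simp [interval, next]

/-! ### Syzygies beyond the finitistic dimension -/

lemma valid_syz {u : ZMod N × ℕ} (hu : D.Valid u) : D.Valid (D.syz u) := by
  obtain ⟨w, hw⟩ := exists_isGen_ker_cover hu
  exact hw.le_len

lemma valid_iterate_syz {u : ZMod N × ℕ} (hu : D.Valid u) (s : ℕ) : D.Valid (D.syz^[s] u) := by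
  induction s generalizing u with
  | zero => exact hu
  | succ s ih => exact ih (valid_syz hu)

variable (D) in
/-- The `t`-th syzygies of the uniserial modules of projective dimension greater than `t`. -/
def survivors (t : ℕ) : Set (ZMod N × ℕ) :=
  {u | ∃ w, D.Valid w ∧ (∀ s ≤ t, D.Proper (D.syz^[s] w)) ∧ D.syz^[t] w = u}

lemma valid_of_mem_survivors {t : ℕ} {u : ZMod N × ℕ} (hu : u ∈ D.survivors t) : D.Valid u := by
  obtain ⟨w, hw, -, rfl⟩ := hu
  exact valid_iterate_syz hw t

lemma mapsTo_syz {t : ℕ} (ht : finDim Λ < t) :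
    Set.MapsTo D.syz (D.survivors t) (D.survivors t) := by
  rintro _ ⟨w, hw, hp, rfl⟩
  have hpos : 0 < (D.syz^[t + 1] w).2 := by
    rw [Function.iterate_succ_apply']
    exact Nat.sub_pos_of_lt (hp t le_rfl).2
  have hlt : D.Proper (D.syz^[t + 1] w) := by
    refine ⟨hpos, lt_of_le_of_ne (valid_iterate_syz hw (t + 1)) fun h => ?_⟩
    have := (le_finDim hw (fun s hs => hp s (by omega)) hpos h).trans_lt ht
    have : t + 1 < t := by exact_mod_cast this
    omega
  refine ⟨D.syz w, valid_syz hw, fun s hs => ?_, ?_⟩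
  · rw [← Function.iterate_succ_apply]
    obtain rfl | hs := hs.eq_or_lt
    · exact hlt
    · exact hp (s + 1) hs
  · rw [← Function.iterate_succ_apply, Function.iterate_succ_apply']

/-- Two distinct `t`-th syzygies with the same syzygy would produce a module of finite projective
dimension `t` or `t + 1`. -/
lemma injOn_syz {t : ℕ} (ht : finDim Λ < t) : Set.InjOn D.syz (D.survivors t) := by
  rintro _ ⟨w, hw, hp, rfl⟩ _ ⟨w', hw', hp', rfl⟩ heq
  obtain ⟨a, b, hab, hb, rfl⟩ := exists_eq_interval hw
  obtain ⟨a', b', hab', hb', rfl⟩ := exists_eq_interval hw'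
  have hP := hp t le_rfl
  have hP' := hp' t le_rfl
  rw [iterate_syz_interval hab hb, proper_interval_iff] at hP
  rw [iterate_syz_interval hab' hb', proper_interval_iff] at hP'
  rw [iterate_syz_interval hab hb, iterate_syz_interval hab' hb', syz_interval hP.1.le,
    syz_interval hP'.1.le] at heq
  -- a shift by a multiple of `N` makes the intervals of the common syzygy equal
  obtain ⟨z, hz⟩ : ∃ z : ℤ, D.endpoint a b (t + 1) = D.endpoint a' b' (t + 1) + N * z := by
    have h := (ZMod.intCast_eq_intCast_iff_dvd_sub _ _ N).1 (congr_arg Prod.fst heq).symm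
    obtain ⟨z, hz⟩ := h
    exact ⟨z, by rw [← hz]; ring⟩
  have hz2 : D.next (D.endpoint a b t) = D.next (D.endpoint a' b' t) + N * z := by
    have h : (D.next (D.endpoint a b t) - D.endpoint a b (t + 1)).toNat =
      (D.next (D.endpoint a' b' t) - D.endpoint a' b' (t + 1)).toNat := congr_arg Prod.snd heq
    omega
  have hshift : ∀ n, D.endpoint (a' + N * z) (b' + N * z) n = D.endpoint a' b' n + N * z :=
    D.endpoint_add_mul a' b' z
  have hgen : interval (N := N) (D.endpoint a' b' t) (D.endpoint a' b' (t + 1)) =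
      interval (D.endpoint a' b' t + N * z) (D.endpoint a' b' (t + 1) + N * z) := by
    simp [interval]
  rw [iterate_syz_interval hab hb, iterate_syz_interval hab' hb', hgen, ← hshift, ← hshift]
  rw [← hshift] at hz
  rw [← next_add_mul, ← hshift] at hz2
  have h1 := hP'.1
  have h2 := hP'.2
  have hPz : D.endpoint (a' + N * z) (b' + N * z) (t + 1) <
      D.next (D.endpoint (a' + N * z) (b' + N * z) t) := by
    rw [hshift, hshift, next_add_mul]; omega
  have hPz' : D.endpoint (a' + N * z) (b' + N * z) t <
      D.endpoint (a' + N * z) (b' + N * z) (t + 1) := by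
    rw [hshift, hshift]; omega
  generalize a' + N * z = a₁ at *
  generalize b' + N * z = b₁ at *
  have key : ∀ a b a₁ b₁ : ℤ, D.endpoint a₁ b₁ t < D.endpoint a b (t + 1) →
      D.endpoint a b (t + 1) < D.next (D.endpoint a b t) →
      D.next (D.endpoint a b t) = D.next (D.endpoint a₁ b₁ t) →
      D.endpoint a₁ b₁ t ≤ D.endpoint a b t := by
    intro a b a₁ b₁ h1 h2 h3
    by_contra! hlt
    obtain ⟨m, hm, p, q, hp, hq⟩ : ∃ m, t ≤ 2 * m + 1 ∧ ∃ p q,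
        D.endpoint a b t = D.next^[m] p ∧ D.endpoint a₁ b₁ t = D.next^[m] q := by
      obtain ⟨m, rfl | rfl⟩ := t.even_or_odd'
      · exact ⟨m, by omega, a, a₁, D.endpoint_two_mul .., D.endpoint_two_mul ..⟩
      · exact ⟨m, le_rfl, b, b₁, D.endpoint_two_mul_add_one .., D.endpoint_two_mul_add_one ..⟩
    rw [hp] at hlt h2 h3
    rw [hq] at h1 hlt h3
    have h := le_finDim_of_collision hlt
      (by rw [Function.iterate_succ_apply']; exact h1.trans h2)
      (by rw [Function.iterate_succ_apply', Function.iterate_succ_apply', h3])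
    have : 2 * m + 1 < t := by exact_mod_cast h.trans_lt ht
    omega
  have hle := key a b a₁ b₁ (by rw [hz]; exact hPz') hP.2 hz2
  have hge := key a₁ b₁ a b (by rw [← hz]; exact hP.1) hPz hz2.symm
  rw [hz, le_antisymm hge hle]

lemma L_pow_cls_uniserial [IsNoetherianRing Λ] {u : ZMod N × ℕ} (hu : D.Valid u) (s : ℕ) :
    (L Λ ^ s) (cls (D.uniserial u)) = cls (D.uniserial (D.syz^[s] u)) := by
  induction s generalizing u with
  | zero => rfl
  | succ s ih =>
    rw [pow_succ, Module.End.mul_apply, L_cls_uniserial hu, ih (valid_syz hu),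
      Function.iterate_succ_apply]

variable [Module.Finite k Λ] [IsNoetherianRing Λ]

lemma range_L_pow_le (D : CyclicPresentation k Λ N) (t : ℕ) :
    LinearMap.range (L Λ ^ t) ≤
      Submodule.span ℤ ((fun u => cls (D.uniserial u)) '' D.survivors t) := by
  rw [LinearMap.range_eq_map, ← D.span_cls_uniserial, Submodule.map_span, Submodule.span_le]
  rintro _ ⟨_, ⟨u, hu, rfl⟩, rfl⟩
  simp only
  by_cases h : ∀ s ≤ t, D.Proper (D.syz^[s] u)
  · rw [L_pow_cls_uniserial hu]
    exact Submodule.subset_span ⟨_, ⟨u, hu, h, rfl⟩, rfl⟩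
  · push Not at h
    obtain ⟨s, hs, hn⟩ := h
    rw [← Nat.sub_add_cancel hs, pow_add, Module.End.mul_apply, L_pow_cls_uniserial hu,
      cls_uniserial_eq_zero (valid_iterate_syz hu s) hn, map_zero]
    exact zero_mem _

/-- Beyond the finitistic dimension, taking syzygies permutes the finite set of surviving uniserial
modules; so a power of `L` is the identity on `L ^ t K₀`. -/
lemma injOn_L (D : CyclicPresentation k Λ N) {t : ℕ} (ht : finDim Λ < t) :
    Set.InjOn (L Λ) (LinearMap.range (L Λ ^ t)) := by
  have : Finite (D.survivors t) :=
    D.finite_valid.subset fun _ => valid_of_mem_survivors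
  let σ : Equiv.Perm (D.survivors t) := Equiv.ofBijective ((mapsTo_syz ht).restrict _ _ _)
    (Finite.injective_iff_bijective.1 ((mapsTo_syz ht).restrict_inj.2 (injOn_syz ht)))
  have hσ : ∀ (n : ℕ) (y : D.survivors t),
      (L Λ ^ n) (cls (D.uniserial y)) = cls (D.uniserial ((σ ^ n) y)) := by
    intro n
    induction n with
    | zero => intro y; rfl
    | succ n ih =>
      intro y
      rw [pow_succ, Module.End.mul_apply, L_cls_uniserial (valid_of_mem_survivors y.2), pow_succ,
        Equiv.Perm.mul_apply, ← ih]
      rfl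
  obtain ⟨n, hn, hσn⟩ := isOfFinOrder_iff_pow_eq_one.1 (isOfFinOrder_of_finite σ)
  have hid : ∀ x ∈ LinearMap.range (L Λ ^ t), (L Λ ^ n) x = x := by
    have hle : LinearMap.range (L Λ ^ t) ≤ LinearMap.eqLocus (L Λ ^ n) LinearMap.id := by
      refine (D.range_L_pow_le t).trans (Submodule.span_le.2 ?_)
      rintro _ ⟨u, hu, rfl⟩
      have := hσ n ⟨u, hu⟩
      rwa [hσn] at this
    exact fun x hx => hle hx
  intro x hx y hy hxy
  rw [← hid x hx, ← hid y hy, ← Nat.sub_add_cancel hn, pow_add, pow_one, Module.End.mul_apply,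
    Module.End.mul_apply, hxy]

lemma phiDim_le (D : CyclicPresentation k Λ N) {t : ℕ} (ht : finDim Λ < t) : phiDim Λ ≤ t :=
  iSup_le fun M => by exact_mod_cast phi_le_of_injOn (D.injOn_L ht) M

end CyclicPresentation

end

theorem theorem1 (k : Type u) [Field k] (Λ : Type v) [Ring Λ] [Algebra k Λ]
    (hΛ : IsCyclicNakayama k Λ) :
    haveI : IsNoetherianRing Λ := hΛ.isNoetherianRing
    ∃ p f : ℕ, Homological.phiDim Λ = p ∧ Homological.finDim Λ = f ∧ (p : ℤ) - f ≤ 1 := by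
  have : IsNoetherianRing Λ := hΛ.isNoetherianRing
  obtain ⟨N, _, R, hR, -, ⟨e⟩⟩ := hΛ
  have := CyclicQuiver.BoundQuiverAlgebra.finite k R hR
  have : Module.Finite k Λ := Module.Finite.equiv e.symm.toLinearEquiv
  obtain ⟨r, hr⟩ := hR
  let π : CyclicQuiver.PathAlgebra k N →ₐ[k] Λ :=
    e.symm.toAlgHom.comp ((CyclicQuiver.relIdeal k R).ringCon.mkₐ k)
  have hπ : Function.Surjective π :=
    e.symm.surjective.comp (RingCon.mkₐ_surjective (α := k) (CyclicQuiver.relIdeal k R).ringCon)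
  have hπr : π (CyclicQuiver.PathAlgebra.of k r) = 0 := by
    have : (CyclicQuiver.relIdeal k R).ringCon.mkₐ k (CyclicQuiver.PathAlgebra.of k r) = 0 :=
      ((CyclicQuiver.relIdeal k R).ringCon.eq).2 (TwoSidedIdeal.subset_span ⟨r, hr, rfl⟩)
    exact (congr_arg e.symm this).trans (map_zero e.symm)
  let D := CyclicPresentation.ofSurjective π hπ r hπr
  obtain ⟨f, hf⟩ := ENat.ne_top_iff_exists.1 D.finDim_ne_top
  have hle : Homological.phiDim Λ ≤ (f + 1 : ℕ) :=
    D.phiDim_le (by rw [← hf]; exact_mod_cast Nat.lt_succ_self f)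
  obtain ⟨p, hp⟩ := ENat.ne_top_iff_exists.1 (ne_top_of_le_ne_top (ENat.natCast_ne_top _) hle)
  refine ⟨p, f, hp.symm, hf.symm, ?_⟩
  have : p ≤ f + 1 := by rw [← hp] at hle; exact_mod_cast hle
  omega
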